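/- Let $g(x)=a_0+a_1x+\dots+a_nx^n$ be a complex polynomial of exact degree $n\ge 0$ that is symmetric, i.e. $g(x)=x^n\,\overline{g}(1/x)$, where $\overline{g}$ denotes the polynomial whose coefficients are the complex conjugates of those of $g$ (equivalently, $a_k=\overline{a_{n-k}}$ for $0\le k\le n$). Put $g_\delta(x)=\frac n2\,g(x)-x\,g'(x)$. Roots are counted with multiplicity. (i) For every complex number $z$ with $\operatorname{Re} z>0$, the polynomial $f(x)=g_\delta(x)-z\,g(x)$ is not identically zero, and the number of roots of $f$ in $|x|>1$ equals the number of roots of $g$ in $|x|<1$, and also equals the number of roots of $g$ in $|x|>1$. (ii) (Cohn's theorem.) If $n\ge 1$, then for $z=\frac n2$ one has $f(x)=-x\,g'(x)$, and the number of roots of $g$ in $|x|<1$ equals the number of roots of $g'$ in $|x|>1$. -/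

import Mathlib

open Polynomial

namespace SymmPoly

/-- The polynomial `g* (x) = xⁿ ḡ(1/x)`, where `ḡ` has the conjugate coefficients: for
`g = a₀ + a₁ x + ⋯ + aₙ xⁿ` this is `āₙ + āₙ₋₁ x + ⋯ + ā₀ xⁿ`. -/
noncomputable def conjReciprocal (n : ℕ) (g : ℂ[X]) : ℂ[X] :=
  (g.map (starRingEnd ℂ)).reflect n

/-- `g` is a symmetric polynomial of (exact) degree `n`: `g* = g`, that is `aₖ = conj aₙ₋ₖ`. -/
def IsSymmetric (n : ℕ) (g : ℂ[X]) : Prop :=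
  g.degree = n ∧ conjReciprocal n g = g

/-- `g_δ (x) = (n / 2) g(x) - x g'(x)`. -/
noncomputable def gDelta (n : ℕ) (g : ℂ[X]) : ℂ[X] :=
  C ((n : ℂ) / 2) * g - X * derivative g

/-- The number of roots of `p` in `|x| < 1`, counted with multiplicity. -/
noncomputable def rootsInside (p : ℂ[X]) : ℕ :=
  p.roots.countP (fun x => ‖x‖ < 1)

/-- The number of roots of `p` in `|x| > 1`, counted with multiplicity. -/
noncomputable def rootsOutside (p : ℂ[X]) : ℕ :=
  p.roots.countP (fun x => 1 < ‖x‖)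

end SymmPoly

open Metric Set

/-! ### Root counting on circles; roots of reflections. -/

namespace Polynomial

/-! Since `x g'/g = ∑ x/(x - r)`, the real part of `f/(-g)` is `Re z + ½ ∑ herglotzRe x r` over the
roots `r` of `g`. Symmetry pairs `r` with `1/conj r`, whose kernels cancel on the unit circle, so by
compactness the off-circle roots contribute little nearby; roots on the circle contribute
nonnegatively outside it. Hence `Re (f/(-g)) > 0` on a thin annulus `1 < ‖x‖ ≤ ρ`
(`exists_annulus`). Then `f` and `g` have no roots there and equally many in `‖x‖ < ρ`
(`countP_roots_eq_of_re_div_pos`); both have degree `n`, so the outer counts agree. Cohn's theorem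
follows as the factor `X` of `X * g'` only adds the root `0`. -/

/-- A finite sum of simple poles has winding number the number of enclosed poles. -/
lemma circleIntegral_sum_inv_sub {R : ℝ} (hR : 0 < R) (s : Multiset ℂ)
    (hs : ∀ r ∈ s, ‖r‖ ≠ R) :
    CircleIntegrable (fun x => (s.map fun r => 1 / (x - r)).sum) 0 R ∧
    (∮ x in C(0, R), (s.map fun r => 1 / (x - r)).sum) =
      s.countP (fun r => ‖r‖ < R) * (2 * Real.pi * Complex.I) := by
  induction s using Multiset.induction_on with
  | empty => simp [circleIntegral]
  | cons a s ih =>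
    obtain ⟨hi, he⟩ := ih fun r hr => hs r (Multiset.mem_cons_of_mem hr)
    have ha : ‖a‖ ≠ R := hs a (Multiset.mem_cons_self a s)
    have hai : CircleIntegrable (fun x => 1 / (x - a)) 0 R := by
      refine ContinuousOn.circleIntegrable hR.le ?_
      refine continuousOn_const.div (continuousOn_id.sub continuousOn_const) fun x hx h => ha ?_
      rw [← sub_eq_zero.mp h]
      simpa using hx
    have hint : (∮ x in C(0, R), 1 / (x - a)) =
        (if ‖a‖ < R then 1 else 0 : ℕ) * (2 * Real.pi * Complex.I) := by
      split_ifs with h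
      · simpa using circleIntegral.integral_sub_inv_of_mem_ball (c := 0) (R := R) (w := a)
          (by simpa using h)
      · have : DiffContOnCl ℂ (fun x => 1 / (x - a)) (ball 0 R) := by
          refine DifferentiableOn.diffContOnCl ?_
          rw [closure_ball 0 hR.ne']
          intro x hx
          have hxa : x - a ≠ 0 := fun h0 => by
            rw [sub_eq_zero.mp h0, mem_closedBall, dist_zero_right] at hx
            exact h (lt_of_le_of_ne hx ha)
          exact ((differentiableAt_const _).div
            (differentiableAt_id.sub_const a) hxa).differentiableWithinAt
        simpa using this.circleIntegral_eq_zero hR.le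
    simp only [Multiset.map_cons, Multiset.sum_cons, Multiset.countP_cons]
    refine ⟨hai.add hi, ?_⟩
    rw [circleIntegral.integral_add hai hi, hint, he]
    push_cast
    ring

/-- A one-sided form of Rouché's theorem: if the quotient of two polynomials has positive real
part on a circle, they have equally many roots inside. -/
lemma countP_roots_eq_of_re_div_pos {R : ℝ} (hR : 0 < R) {p q : ℂ[X]}
    (h : ∀ x : ℂ, ‖x‖ = R → 0 < (p.eval x / q.eval x).re) :
    p.roots.countP (fun r => ‖r‖ < R) = q.roots.countP (fun r => ‖r‖ < R) := by
  have hp : ∀ x : ℂ, ‖x‖ = R → p.eval x ≠ 0 := fun x hx h0 => by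
    simpa [h0] using h x hx
  have hq : ∀ x : ℂ, ‖x‖ = R → q.eval x ≠ 0 := fun x hx h0 => by
    -- Division by zero yields `0`, so positivity also excludes zeros of `q`.
    simpa [h0] using h x hx
  obtain ⟨hpi, hpe⟩ := circleIntegral_sum_inv_sub hR p.roots fun r hr hrR =>
    hp r hrR (isRoot_of_mem_roots hr)
  obtain ⟨hqi, hqe⟩ := circleIntegral_sum_inv_sub hR q.roots fun r hr hrR =>
    hq r hrR (isRoot_of_mem_roots hr)
  have key : (∮ x in C(0, R), ((p.roots.map fun r => 1 / (x - r)).sum -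
      (q.roots.map fun r => 1 / (x - r)).sum)) = 0 := by
    -- `p/q` stays in the right half-plane, so the principal logarithm is a primitive along the
    -- whole circle.
    refine circleIntegral.integral_eq_zero_of_hasDerivWithinAt hR.le
      (f := fun x => Complex.log (p.eval x / q.eval x)) fun x hx => ?_
    have hx : ‖x‖ = R := by simpa using hx
    have hpx := hp x hx
    have hqx := hq x hx
    have hd := (((p.hasDerivAt x).div (q.hasDerivAt x) hqx).clog (Or.inl (h x hx)))
    refine (hd.congr_deriv ?_).hasDerivWithinAt
    rw [← (IsAlgClosed.splits p).eval_derivative_div_eval_of_ne_zero hpx,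
      ← (IsAlgClosed.splits q).eval_derivative_div_eval_of_ne_zero hqx]
    simp only [Pi.div_apply]
    field_simp
  rw [circleIntegral.integral_sub hpi hqi, hpe, hqe, sub_eq_zero] at key
  exact_mod_cast mul_right_cancel₀ Complex.two_pi_I_ne_zero key

/-- The roots of the reflection of a monic split polynomial with no root at `0`. -/
lemma roots_reflect_prod_X_sub_C {K : Type*} [Field K] (s : Multiset K) (hs : (0 : K) ∉ s) :
    ((s.map fun r => X - C r).prod.reflect (Multiset.card s)).roots = s.map fun r => r⁻¹ := by
  induction s using Multiset.induction_on with
  | empty => simp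
  | cons a s ih =>
    have ha : a ≠ 0 := fun h => hs (by simp [h])
    have ih := ih fun h => hs (Multiset.mem_cons_of_mem h)
    have hlin : (X - C a : K[X]).reflect 1 = C (-a) * (X - C a⁻¹) := by
      rw [reflect_sub, reflect_one_X, reflect_C, mul_sub, ← C_mul]
      simp [ha]
      ring
    rw [Multiset.map_cons, Multiset.prod_cons, Multiset.card_cons, add_comm,
      reflect_mul _ _ (natDegree_X_sub_C_le a) (natDegree_multiset_prod_X_sub_C_eq_card s).le,
      hlin, roots_mul, roots_C_mul _ (neg_ne_zero.mpr ha), roots_X_sub_C, ih, Multiset.map_cons,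
      Multiset.singleton_add]
    refine mul_ne_zero (mul_ne_zero (C_ne_zero.mpr (neg_ne_zero.mpr ha)) (X_sub_C_ne_zero _)) ?_
    rw [Ne, reflect_eq_zero_iff]
    exact (monic_multiset_prod_of_monic _ _ fun r _ => monic_X_sub_C r).ne_zero

end Polynomial

/-! ### The kernel and inversion in the unit circle. -/

/-- The real part of `(x + r) / (x - r)`. -/
noncomputable def herglotzRe (x r : ℂ) : ℝ :=
  (‖x‖ ^ 2 - ‖r‖ ^ 2) / ‖x - r‖ ^ 2

lemma re_mul_one_div_sub {x r : ℂ} (h : x ≠ r) :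
    (x * (1 / (x - r))).re = 1 / 2 + herglotzRe x r / 2 := by
  have h0 : Complex.normSq (x - r) ≠ 0 := by simpa [sub_eq_zero] using h
  rw [herglotzRe, ← Complex.normSq_eq_norm_sq, ← Complex.normSq_eq_norm_sq,
    ← Complex.normSq_eq_norm_sq, mul_one_div, Complex.div_re]
  field_simp
  simp only [Complex.normSq_apply, Complex.sub_re, Complex.sub_im]
  ring

lemma herglotzRe_inv_conj {x r : ℂ} (hx : ‖x‖ = 1) (hr : r ≠ 0) :
    herglotzRe x (starRingEnd ℂ r)⁻¹ = -herglotzRe x r := by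
  have hr' : ‖r‖ ≠ 0 := norm_ne_zero_iff.mpr hr
  have hc : (starRingEnd ℂ r) ≠ 0 := by simpa using hr
  have hxx : x * starRingEnd ℂ x = 1 := by
    rw [Complex.mul_conj, Complex.normSq_eq_norm_sq, hx]; simp
  have h : ‖x - (starRingEnd ℂ r)⁻¹‖ = ‖x - r‖ / ‖r‖ := by
    have : x - (starRingEnd ℂ r)⁻¹ = -(x * starRingEnd ℂ (x - r)) / starRingEnd ℂ r := by
      rw [map_sub, mul_sub, hxx]
      field_simp
      ring
    rw [this, norm_div, norm_neg, norm_mul, hx, Complex.norm_conj, Complex.norm_conj, one_mul]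
  rw [herglotzRe, herglotzRe, h, norm_inv, Complex.norm_conj, hx]
  -- If `x = r`, both kernels are `0` by the convention for division by zero.
  by_cases h0 : ‖x - r‖ = 0
  · simp [h0]
  · field_simp
    ring

/-! ### Roots of symmetric polynomials. -/

namespace SymmPoly

variable {n : ℕ} {g : ℂ[X]}

lemma IsSymmetric.ne_zero (hg : IsSymmetric n g) : g ≠ 0 := by
  rintro rfl
  simpa using hg.1

lemma IsSymmetric.natDegree_eq (hg : IsSymmetric n g) : g.natDegree = n :=
  natDegree_eq_of_degree_eq_some hg.1

lemma IsSymmetric.card_roots (hg : IsSymmetric n g) : Multiset.card g.roots = n := by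
  rw [IsAlgClosed.card_roots_eq_natDegree, hg.natDegree_eq]

lemma IsSymmetric.zero_notMem_roots (hg : IsSymmetric n g) : (0 : ℂ) ∉ g.roots := by
  intro h
  have h0 : g.coeff 0 = 0 := by
    rw [coeff_zero_eq_eval_zero]
    exact isRoot_of_mem_roots h
  rw [← hg.2, conjReciprocal, coeff_reflect, revAt_le (Nat.zero_le n), coeff_map, Nat.sub_zero,
    ← hg.natDegree_eq] at h0
  exact hg.ne_zero (leadingCoeff_eq_zero.mp (by simpa using h0))

/-- The roots of a symmetric polynomial are invariant under inversion in the unit circle. -/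
lemma IsSymmetric.roots_map (hg : IsSymmetric n g) :
    g.roots.map (fun r => (starRingEnd ℂ r)⁻¹) = g.roots := by
  set t := g.roots.map (starRingEnd ℂ) with ht
  have h0 : (0 : ℂ) ∉ t := by
    intro h
    obtain ⟨r, hr, hr0⟩ := Multiset.mem_map.mp h
    exact hg.zero_notMem_roots (by rwa [(map_eq_zero _).mp hr0] at hr)
  have hcard : Multiset.card t = n := by rw [ht, Multiset.card_map, hg.card_roots]
  have hfac : g.map (starRingEnd ℂ) =
      C (starRingEnd ℂ g.leadingCoeff) * (t.map fun r => X - C r).prod := by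
    conv_lhs => rw [(IsAlgClosed.splits g).eq_prod_roots]
    rw [Polynomial.map_mul, map_C, Polynomial.map_multiset_prod, ht, Multiset.map_map,
      Multiset.map_map]
    simp
  have hroots : (conjReciprocal n g).roots = t.map fun r => r⁻¹ := by
    rw [conjReciprocal, hfac, reflect_C_mul, roots_C_mul, ← hcard,
      roots_reflect_prod_X_sub_C t h0]
    simpa using hg.ne_zero
  rw [hg.2, ht, Multiset.map_map] at hroots
  exact hroots.symm

lemma IsSymmetric.rootsInside_eq_rootsOutside (hg : IsSymmetric n g) :
    rootsInside g = rootsOutside g := by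
  rw [rootsOutside, rootsInside]
  conv_rhs => rw [← hg.roots_map, Multiset.countP_map]
  rw [Multiset.countP_eq_card_filter]
  congr 1
  refine Multiset.filter_congr fun r hr => ?_
  have hr0 : 0 < ‖r‖ := norm_pos_iff.mpr fun h => hg.zero_notMem_roots (h ▸ hr)
  rw [norm_inv, Complex.norm_conj, one_lt_inv₀ hr0]

/-- On the unit circle, the roots off the circle contribute nothing to `Re (x g' / g)`. -/
lemma IsSymmetric.sum_herglotzRe_eq_zero (hg : IsSymmetric n g) {x : ℂ} (hx : ‖x‖ = 1) :
    ((g.roots.filter fun r => ‖r‖ ≠ 1).map (herglotzRe x)).sum = 0 := by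
  have hinv : (g.roots.filter fun r => ‖r‖ ≠ 1).map (fun r => (starRingEnd ℂ r)⁻¹) =
      g.roots.filter fun r => ‖r‖ ≠ 1 := by
    conv_rhs => rw [← hg.roots_map, Multiset.filter_map]
    simp [inv_eq_one]
  have hneg : ((g.roots.filter fun r => ‖r‖ ≠ 1).map (herglotzRe x)).sum =
      -((g.roots.filter fun r => ‖r‖ ≠ 1).map (herglotzRe x)).sum := by
    conv_lhs => rw [← hinv]
    rw [← Multiset.sum_map_neg', Multiset.map_map, Multiset.map_map]
    congr 1
    refine Multiset.map_congr rfl fun r hr => ?_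
    exact herglotzRe_inv_conj hx fun h =>
      hg.zero_notMem_roots (h ▸ (Multiset.mem_filter.mp hr).1)
  linarith

/-- Each of the `n` roots contributes `1/2` besides its kernel; the `n/2` in `gDelta` cancels these.
-/
lemma IsSymmetric.re_eval_div (hg : IsSymmetric n g) (z : ℂ) {x : ℂ} (hx : g.eval x ≠ 0) :
    ((gDelta n g - C z * g).eval x / (-g).eval x).re =
      z.re + (g.roots.map (herglotzRe x)).sum / 2 := by
  have hsum : ∀ s : Multiset ℂ, (∀ r ∈ s, x ≠ r) →
      (x * (s.map fun r => 1 / (x - r)).sum).re =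
        Multiset.card s / 2 + (s.map (herglotzRe x)).sum / 2 := by
    intro s
    induction s using Multiset.induction_on with
    | empty => simp
    | cons a s ih =>
      intro h
      have := ih fun r hr => h r (Multiset.mem_cons_of_mem hr)
      simp only [Multiset.map_cons, Multiset.sum_cons, Multiset.card_cons, mul_add,
        Complex.add_re, this, re_mul_one_div_sub (h a (Multiset.mem_cons_self a s))]
      push_cast
      ring
  have hne : ∀ r ∈ g.roots, x ≠ r := fun r hr h => hx (h ▸ isRoot_of_mem_roots hr)
  have hquot : (gDelta n g - C z * g).eval x / (-g).eval x =
      z + x * (g.derivative.eval x / g.eval x) - ((n / 2 : ℝ) : ℂ) := by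
    simp only [gDelta, eval_sub, eval_mul, eval_C, eval_X, eval_neg]
    push_cast
    field_simp
    ring
  rw [hquot, (IsAlgClosed.splits g).eval_derivative_div_eval_of_ne_zero hx, Complex.sub_re,
    Complex.add_re, hsum _ hne, hg.card_roots, Complex.ofReal_re]
  ring

/-- Just outside the unit circle, `f / (-g)` takes values in the right half-plane. -/
lemma IsSymmetric.exists_annulus (hg : IsSymmetric n g) {z : ℂ} (hz : 0 < z.re) :
    ∃ ρ : ℝ, 1 < ρ ∧ ∀ x : ℂ, 1 < ‖x‖ → ‖x‖ ≤ ρ →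
      0 < ((gDelta n g - C z * g).eval x / (-g).eval x).re := by
  set s := g.roots.filter fun r => ‖r‖ ≠ 1 with hs
  set V : Set ℂ := {x | x ∉ s.toFinset} with hV
  have hVo : IsOpen V := (s.toFinset.finite_toSet.isClosed).isOpen_compl
  have hcont : ∀ m : Multiset ℂ, (∀ r ∈ m, r ∈ s) →
      ContinuousOn (fun x => (m.map (herglotzRe x)).sum) V := by
    intro m
    induction m using Multiset.induction_on with
    | empty => simpa using continuousOn_const
    | cons a m ih =>
      intro h
      simp only [Multiset.map_cons, Multiset.sum_cons]
      refine ContinuousOn.add ?_ (ih fun r hr => h r (Multiset.mem_cons_of_mem hr))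
      unfold herglotzRe
      refine ContinuousOn.div (by fun_prop) (by fun_prop) fun x hx h0 => ?_
      have hxa : x = a := by simpa [sub_eq_zero] using h0
      exact hx (Multiset.mem_toFinset.mpr (hxa ▸ h a (Multiset.mem_cons_self a m)))
  -- Below `-2 Re z` the off-circle sum could outweigh `Re z`.
  set U : Set ℂ := V ∩ (fun x => (s.map (herglotzRe x)).sum) ⁻¹' Ioi (-(2 * z.re)) with hU
  have hUo : IsOpen U := (hcont s fun _ => id).isOpen_inter_preimage hVo isOpen_Ioi
  have hsub : sphere (0 : ℂ) 1 ⊆ U := by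
    intro x hx
    have hx : ‖x‖ = 1 := by simpa using hx
    refine ⟨fun h => ?_, ?_⟩
    · exact (Multiset.mem_filter.mp (Multiset.mem_toFinset.mp h)).2 hx
    · change -(2 * z.re) < (s.map (herglotzRe x)).sum
      rw [hg.sum_herglotzRe_eq_zero hx]
      linarith
  obtain ⟨δ, hδ, hthick⟩ := (isCompact_sphere (0 : ℂ) 1).exists_thickening_subset_open hUo hsub
  refine ⟨1 + δ / 2, by linarith, fun x hx1 hx2 => ?_⟩
  have hx0 : (‖x‖ : ℂ) ≠ 0 := by
    exact_mod_cast (by linarith : ‖x‖ ≠ 0)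
  have hxU : x ∈ U := by
    -- The radial projection of `x` lies at distance `‖x‖ - 1 ≤ δ/2 < δ`.
    refine hthick (mem_thickening_iff.mpr ⟨x / ‖x‖, ?_, ?_⟩)
    · have : ‖x‖ ≠ 0 := by exact_mod_cast hx0
      simp [this]
    · have : x - x / ‖x‖ = (x / ‖x‖) * ((‖x‖ - 1 : ℝ) : ℂ) := by
        push_cast
        field_simp
      have h1 : ‖x‖ ≠ 0 := by exact_mod_cast hx0
      rw [dist_eq_norm, this, norm_mul, norm_div, Complex.norm_real, Complex.norm_real, norm_norm,
        div_self h1, one_mul, Real.norm_eq_abs, abs_of_pos (by linarith)]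
      linarith
  have hgx : g.eval x ≠ 0 := fun h =>
    hxU.1 (Multiset.mem_toFinset.mpr (Multiset.mem_filter.mpr
      ⟨(mem_roots hg.ne_zero).mpr h, hx1.ne'⟩))
  rw [hg.re_eval_div z hgx]
  have hsplit : (g.roots.map (herglotzRe x)).sum = (s.map (herglotzRe x)).sum +
      ((g.roots.filter fun r => ¬ ‖r‖ ≠ 1).map (herglotzRe x)).sum := by
    rw [← Multiset.sum_add, ← Multiset.map_add, hs, Multiset.filter_add_not]
  have hcirc : 0 ≤ ((g.roots.filter fun r => ¬ ‖r‖ ≠ 1).map (herglotzRe x)).sum := by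
    refine Multiset.sum_nonneg fun y hy => ?_
    obtain ⟨r, hr, rfl⟩ := Multiset.mem_map.mp hy
    have hr1 : ‖r‖ = 1 := not_not.mp (Multiset.mem_filter.mp hr).2
    refine div_nonneg ?_ (sq_nonneg _)
    rw [hr1]
    nlinarith
  have : -(2 * z.re) < (s.map (herglotzRe x)).sum := hxU.2
  linarith

/-- The coefficient of `xⁿ` is `-(n/2 + z) aₙ`, and `n/2 + z` has positive real part. -/
lemma IsSymmetric.natDegree_gDelta_sub (hg : IsSymmetric n g) {z : ℂ} (hz : 0 < z.re) :
    (gDelta n g - C z * g).natDegree = n := by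
  have hle : ∀ p q : ℂ[X], p.natDegree ≤ n → q.natDegree ≤ n → (p - q).natDegree ≤ n :=
    fun p q hp hq => (natDegree_sub_le p q).trans (max_le hp hq)
  have hC : ∀ c : ℂ, (C c * g).natDegree ≤ n := fun c =>
    (natDegree_C_mul_le c g).trans hg.natDegree_eq.le
  have hcoeff : ∀ p : ℂ[X], (X * derivative p).coeff n = n * p.coeff n := by
    intro p
    cases n with
    | zero => simp
    | succ k => rw [coeff_X_mul, coeff_derivative]; push_cast; ring
  have hX : (X * derivative g).natDegree ≤ n := by
    refine natDegree_le_iff_coeff_eq_zero.mpr fun N hN => ?_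
    obtain ⟨k, rfl⟩ := Nat.exists_eq_add_of_lt hN
    rw [coeff_X_mul, coeff_derivative, coeff_eq_zero_of_natDegree_lt, zero_mul]
    rw [hg.natDegree_eq]
    omega
  refine natDegree_eq_of_le_of_coeff_ne_zero (hle _ _ (hle _ _ (hC _) hX) (hC z)) ?_
  have hlead : g.coeff n ≠ 0 := by
    have := leadingCoeff_ne_zero.mpr hg.ne_zero
    rwa [leadingCoeff, hg.natDegree_eq] at this
  have : (gDelta n g - C z * g).coeff n = -(n / 2 + z) * g.coeff n := by
    simp only [gDelta, coeff_sub, coeff_C_mul, hcoeff]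
    ring
  rw [this]
  refine mul_ne_zero (neg_ne_zero.mpr fun h => ?_) hlead
  have hre : ((n / 2 : ℝ) : ℂ).re + z.re = 0 := by
    rw [← Complex.add_re]
    push_cast
    rw [h, Complex.zero_re]
  rw [Complex.ofReal_re] at hre
  have : (0 : ℝ) ≤ n / 2 := by positivity
  linarith

/-- If a polynomial has no roots with `1 < ‖x‖ ≤ ρ`, its outer roots are those outside
`‖x‖ < ρ`. -/
lemma rootsOutside_add_countP {p : ℂ[X]} {ρ : ℝ} (hρ : 1 < ρ)
    (hp : ∀ x : ℂ, 1 < ‖x‖ → ‖x‖ ≤ ρ → p.eval x ≠ 0) :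
    rootsOutside p + p.roots.countP (fun x => ‖x‖ < ρ) = p.natDegree := by
  rw [← IsAlgClosed.card_roots_eq_natDegree, rootsOutside,
    Multiset.card_eq_countP_add_countP (fun x : ℂ => 1 < ‖x‖) p.roots]
  congr 1
  rw [Multiset.countP_eq_card_filter, Multiset.countP_eq_card_filter]
  congr 1
  refine Multiset.filter_congr fun x hx => ⟨fun h h1 => ?_, fun h => ?_⟩
  · exact hp x h1 h.le (isRoot_of_mem_roots hx)
  · linarith [not_lt.mp h]

lemma IsSymmetric.rootsOutside_gDelta_sub (hg : IsSymmetric n g) {z : ℂ} (hz : 0 < z.re) :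
    rootsOutside (gDelta n g - C z * g) = rootsOutside g := by
  obtain ⟨ρ, hρ, h⟩ := hg.exists_annulus hz
  have hf := rootsOutside_add_countP (p := gDelta n g - C z * g) hρ fun x h1 h2 h0 => by
    simpa [h0] using h x h1 h2
  have hg' := rootsOutside_add_countP (p := g) hρ fun x h1 h2 h0 => by
    simpa [h0] using h x h1 h2
  have heq := countP_roots_eq_of_re_div_pos (by linarith : 0 < ρ) (fun x hx =>
    h x (by rw [hx]; exact hρ) hx.le)
  rw [roots_neg] at heq
  rw [hg.natDegree_gDelta_sub hz] at hf
  rw [hg.natDegree_eq] at hg'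
  omega

lemma IsSymmetric.gDelta_sub_ne_zero (hg : IsSymmetric n g) {z : ℂ} (hz : 0 < z.re) :
    gDelta n g - C z * g ≠ 0 := by
  obtain ⟨ρ, hρ, h⟩ := hg.exists_annulus hz
  intro h0
  have hn : ‖(ρ : ℂ)‖ = ρ := by rw [Complex.norm_real, Real.norm_of_nonneg (by linarith)]
  have := h ρ (by rw [hn]; exact hρ) hn.le
  simp [h0] at this

end SymmPoly

theorem theorem3 (n : ℕ) (g : Polynomial ℂ) (hg : SymmPoly.IsSymmetric n g) :
    (∀ z : ℂ, 0 < z.re →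
      SymmPoly.gDelta n g - Polynomial.C z * g ≠ 0 ∧
      SymmPoly.rootsOutside (SymmPoly.gDelta n g - Polynomial.C z * g) =
        SymmPoly.rootsInside g ∧
      SymmPoly.rootsOutside (SymmPoly.gDelta n g - Polynomial.C z * g) =
        SymmPoly.rootsOutside g) ∧
    (1 ≤ n →
      SymmPoly.gDelta n g - Polynomial.C ((n : ℂ) / 2) * g =
        -(Polynomial.X * Polynomial.derivative g) ∧
      SymmPoly.rootsInside g = SymmPoly.rootsOutside (Polynomial.derivative g)) := by
  refine ⟨fun z hz => ⟨hg.gDelta_sub_ne_zero hz, ?_, hg.rootsOutside_gDelta_sub hz⟩, fun hn => ?_⟩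
  · rw [hg.rootsOutside_gDelta_sub hz, hg.rootsInside_eq_rootsOutside]
  · have heq : SymmPoly.gDelta n g - Polynomial.C ((n : ℂ) / 2) * g =
        -(Polynomial.X * Polynomial.derivative g) := by
      rw [SymmPoly.gDelta]
      ring
    have hz : 0 < ((n : ℂ) / 2).re := by
      have : (0 : ℝ) < n := by exact_mod_cast hn
      simpa using this
    refine ⟨heq, ?_⟩
    have hne := hg.gDelta_sub_ne_zero hz
    have hout := hg.rootsOutside_gDelta_sub hz
    rw [heq] at hne hout
    rw [hg.rootsInside_eq_rootsOutside, ← hout, SymmPoly.rootsOutside, roots_neg,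
      roots_mul (neg_ne_zero.mp hne), roots_X, Multiset.countP_add]
    simp [SymmPoly.rootsOutside, Multiset.countP_eq_zero]
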